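/- Let $X$ be a real or complex Banach space and let $\mathcal S=\{T(t)\}_{t\ge 0}$ be a bounded $C_0$-semigroup on $X$. Let $$X^\odot:=\{x^*\in X^*:\ \lim_{t\to 0}\|T^*(t)x^*-x^*\|=0\},$$ let $T^\odot(t)$ be the restriction of $T^*(t)$ to the closed invariant subspace $X^\odot$, and write $O(x^\odot):=\{T^\odot(t)x^\odot:t\ge 0\}$ for $x^\odot\in X^\odot$. Let $\eta:L(X,X^{**})\to L(X^*)$ be the bijection given by $\langle x,\eta(U)x^*\rangle=\langle Ux,x^*\rangle$. Give $L(X^*)$ the topology of pointwise convergence of $\langle x,Ux^*\rangle$ for $x\in X$, $x^*\in X^*$, and let $\mathcal S_0:=\eta^{-1}(\overline{\eta(\mathcal S)})$, where $L(X)\subset L(X,X^{**})$ via $X\subset X^{**}$. Let $\mathcal S_0^\odot$ be the set of all $W\in L(X^\odot)$ for which there is a $V\in\mathcal S_0$ with $\langle x,Wx^\odot\rangle=\langle Vx,x^\odot\rangle$ for all $x\in X$, $x^\odot\in X^\odot$. A minimal idempotent of $\mathcal S_0^\odot$ is a $P\in\mathcal S_0^\odot$ with $P^2=P$ such that every $Q\in\mathcal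 S_0^\odot$ with $Q^2=Q$ and $QP=Q$ satisfies $PQ=P$. **Theorem.** $\mathcal S_0^\odot$ has a minimal idempotent. Let $P^\odot$ be any minimal idempotent of $\mathcal S_0^\odot$. Then $X^\odot$ is the direct sum of $X_a^\odot:=R(P^\odot)$ (the range) and $X_0^\odot:=N(P^\odot)$ (the kernel), and both are closed and invariant under every $T^\odot(t)$. Moreover: 1. $P^\odot\mathcal S_0^\odot$ is a group on $X_a^\odot$: the operators $y\mapsto P^\odot Vy$ on $X_a^\odot$, $V\in\mathcal S_0^\odot$, form a group under composition whose neutral element is the identity of $X_a^\odot$. 2. $x^\odot\in X_a^\odot$ if and only if for every $V\in\mathcal S_0^\odot$ there is a $U\in\mathcal S_0^\odot$ with $P^\odot UP^\odot Vx^\odot=x^\odot$. 3. If $x^\odot\in X_0^\odot$, then there is a net $(t_\gamma)$ in $[0,\infty)$ with $\sigma(X^\odot,X)\text{-}\lim_\gamma T^\odot(t_\gamma)x^\odot=0$. 4. Let $x^\odot\in X^\odot$ be such that $t\mapsto T^\odot(t)x^\odot$ is almost periodic, i.e. the restriction to $[0,\infty)$ of a bounded continuous $f:\mathbb R\to X^\odot$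 whose set of translates $\{f(\cdot+\tau):\tau\in\mathbb R\}$ is relatively compact for the sup norm. Then $x^\odot\in X_a^\odot$. 5. Let $x^\odot\in X^\odot$. If there is a net $(t_\alpha)$ in $[0,\infty)$ with $T^\odot(t_\alpha)x^\odot\to 0$ in the weak topology $\sigma(X^\odot,X^{\odot*})$, then $x^\odot\in X_0^\odot$. 6. If $x\in X$ and $\langle x,x^\odot\rangle=0$ for all $x^\odot\in X_a^\odot$, then there is a net $(t_\alpha)$ in $[0,\infty)$ with $\sigma(X,X^\odot)\text{-}\lim_\alpha T(t_\alpha)x=0$. 7. If $x\in X$ and $\langle x,x^\odot\rangle=0$ for all $x^\odot\in X_0^\odot$, then there is a net $(t_\alpha)$ in $[0,\infty)$ with $\sigma(X,X^\odot)\text{-}\lim_\alpha T(t_\alpha)x=x$. 8. Let $Y\subset X^\odot$ be a norm-closed subspace. If $x^\odot\in Y$ and $\overline{O(x^\odot)}^{\sigma(X^\odot,X)}\subset Y$, then the components $x_a^\odot\in X_a^\odot$ and $x_0^\odot\in X_0^\odot$ of $x^\odot=x_a^\odot+x_0^\odot$ lie in $Y$. Consequently, if this inclusion holds for all $x^\odot\in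 Y$, then $Y=(Y\cap X_a^\odot)\oplus(Y\cap X_0^\odot)$. -/

import Mathlib

open Filter Topology
open scoped NNReal BoundedContinuousFunction

/-- A bounded `C₀`-semigroup `{T(t)}_{t ≥ 0}` of bounded linear operators on `X`. -/
structure BoundedC0Semigroup (𝕜 X : Type*) [RCLike 𝕜] [NormedAddCommGroup X]
    [NormedSpace 𝕜 X] where
  /-- the operator `T(t)` -/
  op : ℝ≥0 → X →L[𝕜] X
  op_zero : op 0 = ContinuousLinearMap.id 𝕜 X
  op_add : ∀ s t : ℝ≥0, op (s + t) = (op s).comp (op t)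
  tendsto_op_zero : ∀ x : X, Tendsto (fun t : ℝ≥0 => op t x) (𝓝 0) (𝓝 x)
  bounded : ∃ M : ℝ, ∀ t : ℝ≥0, ‖op t‖ ≤ M

namespace BoundedC0Semigroup

variable {𝕜 X : Type*} [RCLike 𝕜] [NormedAddCommGroup X] [NormedSpace 𝕜 X]

/-- The sun dual `X^⊙`: all `φ ∈ X*` with `T*(t) φ → φ` in norm as `t → 0`,
where `T*(t) φ = φ ∘ T(t)`. -/
def sunDual (T : BoundedC0Semigroup 𝕜 X) : Submodule 𝕜 (StrongDual 𝕜 X) where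
  carrier := {φ | Tendsto (fun t : ℝ≥0 => φ.comp (T.op t)) (𝓝 0) (𝓝 φ)}
  zero_mem' := by simp
  add_mem' := by
    intro φ ψ hφ hψ
    simpa [ContinuousLinearMap.add_comp] using Tendsto.add hφ hψ
  smul_mem' := by
    intro c φ hφ
    simpa [ContinuousLinearMap.smul_comp] using Tendsto.const_smul hφ c

theorem comp_mem_sunDual (T : BoundedC0Semigroup 𝕜 X) (t : ℝ≥0) {φ : StrongDual 𝕜 X}
    (hφ : φ ∈ T.sunDual) : φ.comp (T.op t) ∈ T.sunDual := by
  have h : Tendsto (fun s : ℝ≥0 => (φ.comp (T.op s)).comp (T.op t)) (𝓝 0)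
      (𝓝 (φ.comp (T.op t))) :=
    (((ContinuousLinearMap.compL 𝕜 X X 𝕜).flip (T.op t)).continuous.tendsto φ).comp hφ
  refine h.congr fun s => ?_
  rw [ContinuousLinearMap.comp_assoc, ContinuousLinearMap.comp_assoc, ← T.op_add, ← T.op_add,
    add_comm]

/-- The operators `T^⊙(t)` on `X^⊙`: the restrictions of the adjoints `T*(t)`. -/
noncomputable def sunOp (T : BoundedC0Semigroup 𝕜 X) (t : ℝ≥0) : T.sunDual →L[𝕜] T.sunDual :=
  ((((ContinuousLinearMap.compL 𝕜 X X 𝕜).flip (T.op t)).comp T.sunDual.subtypeL).codRestrict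
    T.sunDual fun φ => T.comp_mem_sunDual t φ.2)

theorem sunOp_apply (T : BoundedC0Semigroup 𝕜 X) (t : ℝ≥0) (φ : T.sunDual) (x : X) :
    (T.sunOp t φ : StrongDual 𝕜 X) x = (φ : StrongDual 𝕜 X) (T.op t x) := rfl

/-- The weak* topology `σ(X^⊙, X)` on `X^⊙`. -/
abbrev sunWeakStar (T : BoundedC0Semigroup 𝕜 X) : TopologicalSpace T.sunDual :=
  TopologicalSpace.induced (fun (φ : T.sunDual) (x : X) => (φ : StrongDual 𝕜 X) x)
    Pi.topologicalSpace

/-- The topology `σ(X, X^⊙)` on `X`. -/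
abbrev sunWeak (T : BoundedC0Semigroup 𝕜 X) : TopologicalSpace X :=
  TopologicalSpace.induced (fun (x : X) (φ : T.sunDual) => (φ : StrongDual 𝕜 X) x)
    Pi.topologicalSpace

/-- The orbit `O(φ) = {T^⊙(t) φ : t ≥ 0}` of a vector of `X^⊙`. -/
def sunOrbit (T : BoundedC0Semigroup 𝕜 X) (φ : T.sunDual) : Set T.sunDual :=
  Set.range fun t : ℝ≥0 => T.sunOp t φ

/-- The weak* operator topology on `L(E, F*)`: pointwise convergence of `⟨U x, y⟩`
for `x ∈ E`, `y ∈ F`. -/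
abbrev weakStarOT (𝕜 E F : Type*) [RCLike 𝕜] [NormedAddCommGroup E] [NormedSpace 𝕜 E]
    [NormedAddCommGroup F] [NormedSpace 𝕜 F] : TopologicalSpace (E →L[𝕜] StrongDual 𝕜 F) :=
  TopologicalSpace.induced (fun (U : E →L[𝕜] StrongDual 𝕜 F) (p : E × F) => U p.1 p.2)
    Pi.topologicalSpace

/-- The isometric bijection `η : L(X, X**) → L(X*)` with `⟨x, η(U) φ⟩ = ⟨U x, φ⟩`. -/
noncomputable def eta (U : X →L[𝕜] StrongDual 𝕜 (StrongDual 𝕜 X)) :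
    StrongDual 𝕜 X →L[𝕜] StrongDual 𝕜 X :=
  ContinuousLinearMap.flip U

/-- The compactification `𝒮₀ ⊆ L(X, X**)` of `𝒮 = {T(t)}_{t ≥ 0} ⊆ L(X) ⊆ L(X, X**)`: the
preimage under `η` of the weak* operator closure of `η(𝒮)` in `L(X*)`. -/
def compactification (T : BoundedC0Semigroup 𝕜 X) :
    Set (X →L[𝕜] StrongDual 𝕜 (StrongDual 𝕜 X)) :=
  eta ⁻¹' @closure _ (weakStarOT 𝕜 (StrongDual 𝕜 X) X)
    (Set.range fun t : ℝ≥0 =>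
      eta ((NormedSpace.inclusionInDoubleDual 𝕜 X).comp (T.op t)))

/-- The compactification `𝒮₀^⊙ = η^⊙(𝒮₀)` in `L(X^⊙)`, where `η^⊙(V) = W` means that
`⟨x, W φ⟩ = ⟨V x, φ⟩` for all `x ∈ X` and `φ ∈ X^⊙`. -/
def sunCompactification (T : BoundedC0Semigroup 𝕜 X) : Set (T.sunDual →L[𝕜] T.sunDual) :=
  {W | ∃ V ∈ T.compactification, ∀ (φ : T.sunDual) (x : X),
    (W φ : StrongDual 𝕜 X) x = V x (φ : StrongDual 𝕜 X)}

/-- `P` is a minimal idempotent of the set `S` of operators: it is an idempotent in `S` and is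
minimal among those for the relation `e ≤_L f ↔ e f = e`. (By pure algebra, minimality for
`e ≤_R f ↔ f e = e` is the same when `S` is a semigroup.) -/
def IsMinimalIdempotent {R E : Type*} [Semiring R] [AddCommMonoid E] [Module R E]
    [TopologicalSpace E]
    (S : Set (E →L[R] E)) (P : E →L[R] E) : Prop :=
  P ∈ S ∧ P.comp P = P ∧
    ∀ Q ∈ S, Q.comp Q = Q → Q.comp P = Q → P.comp Q = P

/-- The set `P S` restricted to `R(P)`: all operators `R(P) → R(P)`, `y ↦ P V y`, `V ∈ S`. -/
def restrictedToRange {R E : Type*} [Semiring R] [AddCommMonoid E] [Module R E]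
    [TopologicalSpace E]
    (S : Set (E →L[R] E)) (P : E →L[R] E) : Set (P.range →L[R] P.range) :=
  (fun V : E →L[R] E => (P.rangeRestrict.comp V).comp P.range.subtypeL) '' S

/-- `P S` is a group on `R(P)`: the operators `y ↦ P V y`, `V ∈ S`, form a group of operators on
`R(P)` under composition, with neutral element the identity of `R(P)`. In other words, they are a
subgroup of the group of invertible bounded operators on `R(P)`. -/
def IsGroupOnRange {R E : Type*} [Semiring R] [AddCommMonoid E] [Module R E]
    [TopologicalSpace E]
    (S : Set (E →L[R] E)) (P : E →L[R] E) : Prop :=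
  ∃ H : Subgroup (P.range →L[R] P.range)ˣ,
    Units.val '' (H : Set (P.range →L[R] P.range)ˣ) = restrictedToRange S P

/-- `f ∈ C_b(ℝ, E)` is almost periodic if the set of its translates is relatively compact in
`C_b(ℝ, E)`. -/
def IsAlmostPeriodic {E : Type*} [PseudoMetricSpace E] (f : ℝ →ᵇ E) : Prop :=
  IsCompact (closure (Set.range fun τ : ℝ =>
    f.compContinuous ⟨fun t : ℝ => t + τ, continuous_add_const τ⟩))

end BoundedC0Semigroup

/-! The set `T.sunCompactification` consists exactly of the weak* operator limits of `T^⊙(t)` along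
ultrafilters. Iterated limits stay in it, it is compact Hausdorff, and `V ↦ V W` is continuous on
it. The Ellis–Numakura theory of such semigroups gives a minimal idempotent and, for any minimal
idempotent `P` and any `V`, some `U` with `P U P V P = P` (`IsMinimalIdempotent.exists_apply_eq`).

This identity yields the group, the reversibility criterion, and the claim on weakly null nets. `P`
is itself a limit of `T^⊙(t)` along one net, which settles the other net claims and puts `P φ` in
the weak* orbit closure of `φ`. For almost periodic `φ`, compactness makes the orbit of `φ - P φ`
tend to `0` in norm, and large almost periods then force `φ = P φ`. -/

/-! ### Minimal idempotents in compact right topological semigroups. -/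

/-- A compact Hausdorff semigroup with continuous right multiplications has an idempotent that is
minimal for the relation `f * e = f`. -/
theorem exists_minimal_idempotent_of_compact_t2 {M : Type*} [Nonempty M] [Semigroup M]
    [TopologicalSpace M] [CompactSpace M] [T2Space M] (hc : ∀ r : M, Continuous (· * r)) :
    ∃ e : M, e * e = e ∧ ∀ f : M, f * f = f → f * e = f → e * f = e := by
  -- The closed nonempty left ideals; a minimal one contains the desired idempotent.
  let S : Set (Set M) := {L | IsClosed L ∧ L.Nonempty ∧ ∀ m, ∀ l ∈ L, m * l ∈ L}
  obtain ⟨L, hL⟩ : ∃ L, Minimal (· ∈ S) L := by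
    refine zorn_superset _ fun c hcs hch => ?_
    refine ⟨⋂₀ c, ⟨isClosed_sInter fun t ht => (hcs ht).1, ?_, fun m l hl => ?_⟩, fun s hs =>
      Set.sInter_subset_of_mem hs⟩
    · obtain rfl | hne := c.eq_empty_or_nonempty
      · rw [Set.sInter_empty]
        exact Set.univ_nonempty
      rw [Set.sInter_eq_iInter]
      have := hne.coe_sort
      exact IsCompact.nonempty_iInter_of_directed_nonempty_isCompact_isClosed _
        (DirectedOn.directed_val (IsChain.directedOn hch.symm)) (fun i => (hcs i.prop).2.1)
        (fun i => (hcs i.prop).1.isCompact) (fun i => (hcs i.prop).1)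
    · rw [Set.mem_sInter]
      exact fun t ht => (hcs ht).2.2 m l (Set.mem_sInter.mp hl t ht)
  obtain ⟨hLc, hLne, hLmul⟩ := hL.prop
  obtain ⟨e, he, hee⟩ := exists_idempotent_in_compact_subsemigroup hc L hLne hLc.isCompact
    fun x _ y hy => hLmul x y hy
  refine ⟨e, hee, fun f hff hfe => ?_⟩
  have hf : f ∈ L := hfe ▸ hLmul f e he
  -- `M f` is a closed left ideal inside `L`, so minimality gives `e = a f`, whence `e f = a f f =
  -- e`.
  have hLf : Set.range (· * f) = L := by
    refine hL.eq_of_subset ⟨(isCompact_range (hc f)).isClosed, ⟨_, e, rfl⟩, ?_⟩ ?_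
    · rintro m _ ⟨a, rfl⟩
      exact ⟨m * a, mul_assoc _ _ _⟩
    · rintro _ ⟨a, rfl⟩
      exact hLmul a f hf
  obtain ⟨a, rfl⟩ : e ∈ Set.range (· * f) := hLf ▸ he
  simp only [mul_assoc, hff]

/-- If `e` is a minimal idempotent of a compact Hausdorff semigroup with continuous right
multiplications, then every left multiple of `e` generates the same left ideal as `e`. -/
theorem exists_mul_mul_eq_of_minimal_idempotent {M : Type*} [Semigroup M]
    [TopologicalSpace M] [CompactSpace M] [T2Space M] (hc : ∀ r : M, Continuous (· * r))
    {e : M} (hee : e * e = e) (he : ∀ f : M, f * f = f → f * e = f → e * f = e) (a : M) :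
    ∃ b : M, b * (a * e) = e := by
  -- The closed left ideal `M (a e)` contains an idempotent `q = c (a e)`. As `q e = q`, minimality
  -- gives `e q = e`.
  obtain ⟨_, ⟨c, rfl⟩, hq⟩ := exists_idempotent_in_compact_subsemigroup hc
    (Set.range (· * (a * e))) ⟨_, e, rfl⟩ (isCompact_range (hc _)) (by
      rintro _ ⟨x, rfl⟩ _ ⟨y, rfl⟩
      exact ⟨x * (a * e) * y, mul_assoc _ _ _⟩)
  refine ⟨e * c, ?_⟩
  have := he (c * (a * e)) hq (by simp only [mul_assoc, hee])
  rw [mul_assoc, this]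

/-! ### Nets, ultrafilter limits and iterated limits. -/

/-- A filter on a type is the limit of a net indexed by a directed preorder in the same
universe. -/
theorem Filter.exists_net_tendsto.{u} {α : Type u} (F : Filter α) [F.NeBot] :
    ∃ (Γ : Type u) (_ : Preorder Γ) (_ : IsDirectedOrder Γ) (_ : Nonempty Γ) (t : Γ → α),
      Tendsto t atTop F := by
  let Γ := {p : (Set α)ᵒᵈ × α // OrderDual.ofDual p.1 ∈ F ∧ p.2 ∈ OrderDual.ofDual p.1}
  let : Preorder Γ := Preorder.lift fun p => p.1.1
  have hle : ∀ p q : Γ, p ≤ q ↔ OrderDual.ofDual q.1.1 ⊆ OrderDual.ofDual p.1.1 :=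
    fun _ _ => Iff.rfl
  obtain ⟨a₀⟩ : Nonempty α := F.nonempty_of_neBot
  have hne : Nonempty Γ := ⟨⟨(OrderDual.toDual Set.univ, a₀), univ_mem, trivial⟩⟩
  have hdir : IsDirectedOrder Γ := ⟨fun p q => by
    have h := inter_mem p.2.1 q.2.1
    obtain ⟨a, ha⟩ := F.nonempty_of_mem h
    exact ⟨⟨(OrderDual.toDual _, a), h, ha⟩, (hle _ _).2 Set.inter_subset_left,
      (hle _ _).2 Set.inter_subset_right⟩⟩
  refine ⟨Γ, inferInstance, hdir, hne, fun p => p.1.2, fun s hs => ?_⟩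
  obtain ⟨a, ha⟩ := F.nonempty_of_mem hs
  exact mem_map.2 <| mem_of_superset (Ici_mem_atTop (⟨(OrderDual.toDual s, a), hs, ha⟩ : Γ))
    fun p hp => (hle _ _).1 hp p.2.2

/-- A function on ultrafilters given by limits of a fixed function is continuous. -/
theorem continuous_of_tendsto_ultrafilter {α Y : Type*} [TopologicalSpace Y] [RegularSpace Y]
    {g : α → Y} {L : Ultrafilter α → Y} (h : ∀ u : Ultrafilter α, Tendsto g u (𝓝 (L u))) :
    Continuous L := by
  refine continuous_iff_continuousAt.2 fun u => ?_
  -- Closed neighbourhoods are needed: an ultrafilter containing `g ⁻¹' N` has its limit in `N` only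
  -- if `N` is closed.
  refine (closed_nhds_basis (L u)).tendsto_right_iff.2 fun N hN => ?_
  filter_upwards [(ultrafilter_isOpen_basic (g ⁻¹' N)).mem_nhds (h u hN.1)] with v hv
  exact hN.2.mem_of_tendsto (h v) hv

/-- Iterated limits are limits along the bind of filters. -/
theorem Filter.Tendsto.bind_nhds {α β Y : Type*} [TopologicalSpace Y] {F : Filter α}
    {m : α → Filter β} {g : β → Y} {h : α → Y} {y : Y} (hF : Tendsto h F (𝓝 y))
    (hm : ∀ a, Tendsto g (m a) (𝓝 (h a))) : Tendsto g (F.bind m) (𝓝 y) := by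
  rw [Tendsto, map_bind]
  calc (F.bind fun a => map g (m a)) ≤ F.bind (fun a => 𝓝 (h a)) :=
        bind_mono le_rfl (Eventually.of_forall hm)
    _ = (map h F).bind 𝓝 := (bind_map _ _ _).symm
    _ ≤ (𝓝 y).bind 𝓝 := bind_mono hF (Eventually.of_forall fun _ => le_rfl)
    _ = 𝓝 y := nhds_bind_nhds

theorem comap_nhds_neBot_of_mem_closure_range {α Y : Type*} [TopologicalSpace Y] {f : α → Y}
    {y : Y} (h : y ∈ closure (Set.range f)) : (comap f (𝓝 y)).NeBot :=
  comap_neBot fun s hs => by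
    obtain ⟨_, hz, a, rfl⟩ := mem_closure_iff_nhds.1 h s hs
    exact ⟨a, hz⟩

theorem Filter.NeBot.bind {α β : Type*} {F : Filter α} (hF : F.NeBot) {m : α → Filter β}
    (hm : ∀ a, (m a).NeBot) : (F.bind m).NeBot := by
  refine ⟨fun h => ?_⟩
  obtain ⟨a, ha⟩ := F.nonempty_of_mem (mem_bind'.1 (empty_mem_iff_bot.2 h))
  exact (hm a).ne (empty_mem_iff_bot.1 ha)

/-- A norm bounded family of scalars converges along every ultrafilter. -/
theorem Ultrafilter.exists_tendsto_of_norm_le {α E : Type*} [SeminormedAddCommGroup E]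
    [ProperSpace E] (u : Ultrafilter α) {g : α → E} {C : ℝ} (hg : ∀ a, ‖g a‖ ≤ C) :
    ∃ z, Tendsto g u (𝓝 z) := by
  obtain ⟨z, -, hz⟩ := (isCompact_closedBall (0 : E) C).ultrafilter_le_nhds (u.map g)
    (le_principal_iff.2 <| mem_map.2 <| Filter.univ_mem' fun a => by simpa using hg a)
  exact ⟨z, hz⟩

theorem Submodule.inf_sup_inf_eq_left {R E : Type*} [Semiring R] [AddCommMonoid E] [Module R E]
    {A B Y : Submodule R E} (h : ∀ φ ∈ Y, ∃ a ∈ Y ⊓ A, ∃ b ∈ Y ⊓ B, a + b = φ) :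
    (Y ⊓ A) ⊔ (Y ⊓ B) = Y :=
  le_antisymm (sup_le inf_le_left inf_le_left) fun φ hφ => Submodule.mem_sup.2 (h φ hφ)

/-! ### Bounded projections and almost periodic functions. -/

section Idempotent

variable {𝕜 E : Type*} [RCLike 𝕜] [NormedAddCommGroup E] [NormedSpace 𝕜 E] {P : E →L[𝕜] E}

theorem mem_range_iff_of_idempotent (hP : ∀ φ, P (P φ) = P φ) {φ : E} :
    φ ∈ P.range ↔ P φ = φ :=
  ⟨fun ⟨ψ, h⟩ => h ▸ hP ψ, fun h => ⟨φ, h⟩⟩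

theorem sub_mem_ker_of_idempotent (hP : ∀ φ, P (P φ) = P φ) (φ : E) : φ - P φ ∈ P.ker := by
  rw [LinearMap.mem_ker]
  simp [hP]

theorem isCompl_of_idempotent (hP : ∀ φ, P (P φ) = P φ) : IsCompl P.range P.ker := by
  refine ⟨Submodule.disjoint_def.2 fun φ h h' => ?_,
    codisjoint_iff.2 <| eq_top_iff.2 fun φ _ => ?_⟩
  · rw [← (mem_range_iff_of_idempotent hP).1 h]
    exact h'
  · exact Submodule.mem_sup.2 ⟨P φ, ⟨φ, rfl⟩, φ - P φ, sub_mem_ker_of_idempotent hP φ,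
      add_sub_cancel _ _⟩

theorem isClosed_range_of_idempotent (hP : ∀ φ, P (P φ) = P φ) : IsClosed (P.range : Set E) := by
  have : (P.range : Set E) = {φ | P φ = φ} := Set.ext fun φ => mem_range_iff_of_idempotent hP
  rw [this]
  exact isClosed_eq P.continuous continuous_id

theorem components_mem_of_idempotent (hP : ∀ φ, P (P φ) = P φ) {Y : Submodule 𝕜 E} {φ φa φ0 : E}
    (hφ : φ ∈ Y) (hPφ : P φ ∈ Y) (ha : φa ∈ P.range) (h0 : φ0 ∈ P.ker) (h : φ = φa + φ0) :
    φa ∈ Y ∧ φ0 ∈ Y := by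
  have h0' : P φ0 = 0 := h0
  have hPa : P φ = φa := by
    rw [h, map_add, h0', add_zero, (mem_range_iff_of_idempotent hP).1 ha]
  rw [hPa] at hPφ
  exact ⟨hPφ, (Submodule.add_mem_iff_right Y hPφ).1 (h ▸ hφ)⟩

theorem exists_mem_ker_add_eq_of_idempotent (hP : ∀ φ, P (P φ) = P φ) (φ : E) :
    ∃ ψ ∈ P.ker, φ = P φ + ψ :=
  ⟨φ - P φ, sub_mem_ker_of_idempotent hP φ, (add_sub_cancel _ _).symm⟩

theorem exists_norm_lt_of_zero_mem_closure {s : Set E} (h : 0 ∈ closure s) {ε : ℝ} (hε : 0 < ε) :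
    ∃ y ∈ s, ‖y‖ < ε := by
  simpa only [dist_zero_left] using Metric.mem_closure_iff.1 h ε hε

/-- `P` is the identity on its range and `(P V)(P W) = P (V P W)`, so the restrictions form a
monoid. By `hinv` every element has a left inverse in it, which makes it a group. -/
theorem BoundedC0Semigroup.isGroupOnRange_of_idempotent {S : Set (E →L[𝕜] E)}
    (hS : ∀ V ∈ S, ∀ W ∈ S, V.comp W ∈ S) (hPS : P ∈ S) (hP : ∀ φ, P (P φ) = P φ)
    (hinv : ∀ V ∈ S, ∃ U ∈ S, ∀ φ, P (U (P (V (P φ)))) = P φ) : IsGroupOnRange S P := by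
  let r : (E →L[𝕜] E) → (P.range →L[𝕜] P.range) :=
    fun V => (P.rangeRestrict.comp V).comp P.range.subtypeL
  have hone : r P = 1 := by
    ext φ : 2
    exact (hP φ).trans ((mem_range_iff_of_idempotent hP).1 φ.2)
  have hinv : ∀ V ∈ S, ∃ U ∈ S, r U * r V = 1 := by
    intro V hV
    obtain ⟨U, hU, h⟩ := hinv V hV
    refine ⟨U, hU, ?_⟩
    ext φ : 2
    have := h φ
    rwa [(mem_range_iff_of_idempotent hP).1 φ.2] at this
  refine ⟨{ carrier := {u | u.val ∈ restrictedToRange S P}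
            mul_mem' := ?_, one_mem' := ⟨P, hPS, hone⟩, inv_mem' := ?_ }, ?_⟩
  · rintro u v ⟨V, hV, hu⟩ ⟨W, hW, hv⟩
    refine ⟨(V.comp P).comp W, hS _ (hS _ hV _ hPS) _ hW, ?_⟩
    rw [Units.val_mul, ← hu, ← hv]
    rfl
  · rintro u ⟨V, hV, hu⟩
    obtain ⟨U, hU, h⟩ := hinv V hV
    refine ⟨U, hU, ?_⟩
    have hu' : r V = u := hu
    rw [hu'] at h
    exact (Units.inv_eq_of_mul_eq_one_left h).symm
  · refine Set.Subset.antisymm (Set.image_subset_iff.2 fun u hu => hu) ?_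
    rintro _ ⟨V, hV, rfl⟩
    obtain ⟨U, hU, h⟩ := hinv V hV
    -- A left inverse of the left inverse `r U` must equal `r V`, so `r U` is two-sided.
    obtain ⟨V', -, h'⟩ := hinv U hU
    refine ⟨⟨r V, r U, ?_, h⟩, ⟨V, hV, rfl⟩, rfl⟩
    rwa [left_inv_eq_right_inv h' h] at h'

/-- An almost periodic function has arbitrarily large almost periods. -/
theorem BoundedC0Semigroup.IsAlmostPeriodic.exists_dist_lt {F : Type*} [PseudoMetricSpace F] {f : ℝ →ᵇ F}
    (hf : IsAlmostPeriodic f) {ε : ℝ} (hε : 0 < ε) (N : ℝ) :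
    ∃ τ, N ≤ τ ∧ ∀ s, dist (f (s + τ)) (f s) < ε := by
  let R : ℝ := max N 1
  have hR : 0 < R := lt_max_of_lt_right one_pos
  let g : ℕ → (ℝ →ᵇ F) := fun n =>
    f.compContinuous ⟨fun t : ℝ => t + n * R, continuous_add_const (n * R)⟩
  -- Translates by multiples of `R` have a Cauchy subsequence. Two of its terms differ by a shift of
  -- at least `R ≥ N`.
  obtain ⟨a, -, θ, hθ, hlim⟩ := hf.tendsto_subseq (x := g)
    fun n => subset_closure ⟨n * R, rfl⟩
  obtain ⟨k, hk⟩ := Metric.cauchySeq_iff.1 hlim.cauchySeq ε hε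
  have hlt : θ k < θ (k + 1) := hθ k.lt_succ_self
  refine ⟨(θ (k + 1) - θ k : ℝ) * R, ?_, fun s => ?_⟩
  · have : (1 : ℝ) ≤ θ (k + 1) - θ k := by
      rw [le_sub_iff_add_le]
      exact_mod_cast (by omega : 1 + θ k ≤ θ (k + 1))
    exact (le_max_left N 1).trans (le_mul_of_one_le_left hR.le this)
  · have h := (BoundedContinuousFunction.dist_coe_le_dist (s - θ k * R)).trans_lt
      (hk (k + 1) k.le_succ k le_rfl)
    have e₁ : g (θ (k + 1)) (s - θ k * R) = f (s + (θ (k + 1) - θ k : ℝ) * R) :=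
      congr_arg f (by change s - θ k * R + θ (k + 1) * R = _; ring)
    have e₂ : g (θ k) (s - θ k * R) = f s :=
      congr_arg f (by change s - θ k * R + θ k * R = _; ring)
    rwa [Function.comp_apply, Function.comp_apply, e₁, e₂] at h

/-- If the part of an almost periodic function outside of the range of a projection vanishes at
infinity whenever it is contained in a compact set, then the function has values in the range. -/
theorem BoundedC0Semigroup.apply_eq_of_isAlmostPeriodic {f : ℝ →ᵇ E} {φ : E}
    (hf : IsAlmostPeriodic f) (hf0 : f 0 = φ)
    (h : ∀ K : Set E, IsCompact K → (∀ t, f t - P (f t) ∈ K) → ∀ ε : ℝ, 0 < ε →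
      ∃ t₀ : ℝ≥0, ∀ t : ℝ, t₀ ≤ t → ‖f t - P (f t)‖ < ε) : P φ = φ := by
  let D : E →L[𝕜] E := ContinuousLinearMap.id 𝕜 E - P
  let tr : ℝ → (ℝ →ᵇ E) := fun τ =>
    f.compContinuous ⟨fun t : ℝ => t + τ, continuous_add_const τ⟩
  have hK : IsCompact (D '' ((fun g : ℝ →ᵇ E => g 0) '' closure (Set.range tr))) :=
    (hf.image (BoundedContinuousFunction.lipschitz_eval_const (0 : ℝ)).continuous).image
      D.continuous
  have hfK : ∀ t, f t - P (f t) ∈ D '' ((fun g : ℝ →ᵇ E => g 0) '' closure (Set.range tr)) :=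
    fun t => ⟨f t, ⟨tr t, subset_closure ⟨t, rfl⟩, congr_arg f (zero_add t)⟩, rfl⟩
  have hD : D φ = 0 := by
    refine norm_le_zero_iff.1 (le_of_forall_pos_le_add fun ε hε => ?_)
    obtain ⟨t₀, ht₀⟩ := h _ hK hfK _ (half_pos hε)
    -- The constant makes `‖D (φ - f τ)‖ ≤ ε / 2`; the `+ 1` covers `D = 0`.
    obtain ⟨τ, hτ, hfτ⟩ := hf.exists_dist_lt (ε := ε / (2 * (‖D‖ + 1))) (by positivity) t₀
    have h₁ := hfτ 0
    rw [zero_add, hf0, dist_comm, dist_eq_norm, lt_div_iff₀ (by positivity)] at h₁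
    have h₂ := D.le_opNorm (φ - f τ)
    have h₃ : ‖D (f τ)‖ < ε / 2 := ht₀ τ hτ
    have h₄ : ‖D φ‖ ≤ ‖D (φ - f τ)‖ + ‖D (f τ)‖ := by
      simpa using norm_add_le (D (φ - f τ)) (D (f τ))
    nlinarith [norm_nonneg (φ - f τ)]
  exact (sub_eq_zero.1 hD).symm

end Idempotent

theorem tendsto_apply_of_tendsto_toWeakSpace {𝕜 E ι : Type*} [RCLike 𝕜] [AddCommMonoid E]
    [Module 𝕜 E] [TopologicalSpace E] {F : Filter ι} {f : ι → E}
    (h : Tendsto (fun i => toWeakSpace 𝕜 E (f i)) F (𝓝 0)) (ℓ : StrongDual 𝕜 E) :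
    Tendsto (fun i => ℓ (f i)) F (𝓝 0) := by
  have hc := ((WeakBilin.eval_continuous (topDualPairing 𝕜 E).flip ℓ).tendsto 0).comp h
  have h0 : (topDualPairing 𝕜 E).flip (0 : E) ℓ = 0 := by simp
  exact h0 ▸ hc

/-- The closure of a relatively compact set in the coarser topology induced by a continuous
injection is contained in the closure. -/
theorem closure_induced_subset {α β : Type*} [TopologicalSpace α] [T2Space α]
    [TopologicalSpace β] [T2Space β] {f : α → β} (hf : Continuous f) (hinj : Function.Injective f)
    {s K : Set α} (hK : IsCompact K) (hs : s ⊆ K) :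
    @closure α (TopologicalSpace.induced f inferInstance) s ⊆ closure s := by
  have hcomp : IsCompact (closure s) :=
    hK.of_isClosed_subset isClosed_closure (closure_minimal hs hK.isClosed)
  exact @closure_minimal _ (TopologicalSpace.induced f inferInstance) _ _ subset_closure
    (isClosed_induced_iff.2 ⟨_, (hcomp.image hf).isClosed, Set.preimage_image_eq _ hinj⟩)

/-! ### The compactification as a compact semigroup of ultrafilter limits. -/

namespace BoundedC0Semigroup

variable {𝕜 X : Type*} [RCLike 𝕜] [NormedAddCommGroup X] [NormedSpace 𝕜 X]

theorem exists_bound (T : BoundedC0Semigroup 𝕜 X) : ∃ M : ℝ, 0 ≤ M ∧ ∀ t, ‖T.op t‖ ≤ M := by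
  obtain ⟨M, hM⟩ := T.bounded
  exact ⟨M, (norm_nonneg _).trans (hM 0), hM⟩

theorem op_add_apply (T : BoundedC0Semigroup 𝕜 X) (s t : ℝ≥0) (x : X) :
    T.op (s + t) x = T.op s (T.op t x) := by
  rw [T.op_add]; rfl

theorem op_comm_apply (T : BoundedC0Semigroup 𝕜 X) (s t : ℝ≥0) (x : X) :
    T.op s (T.op t x) = T.op t (T.op s x) := by
  rw [← op_add_apply, ← op_add_apply, add_comm]

theorem ext_sunDual {T : BoundedC0Semigroup 𝕜 X} {φ ψ : T.sunDual}
    (h : ∀ x, (φ : StrongDual 𝕜 X) x = (ψ : StrongDual 𝕜 X) x) : φ = ψ :=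
  Subtype.ext (ContinuousLinearMap.ext h)

/-- `W` is the limit of `T^⊙(t)` along `F` in the weak* operator topology. -/
def IsSunLimit (T : BoundedC0Semigroup 𝕜 X) (F : Filter ℝ≥0) (W : T.sunDual →L[𝕜] T.sunDual) :
    Prop :=
  ∀ (φ : T.sunDual) (x : X),
    Tendsto (fun t => (φ : StrongDual 𝕜 X) (T.op t x)) F (𝓝 ((W φ : StrongDual 𝕜 X) x))

/-- Boundedness makes each scalar family converge along `u`, and the limits are bilinear and
bounded. They define functionals on `X*`, hence the values in `X**`. -/
theorem exists_limit_op (T : BoundedC0Semigroup 𝕜 X) (u : Ultrafilter ℝ≥0) :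
    ∃ V : X →L[𝕜] StrongDual 𝕜 (StrongDual 𝕜 X), ∀ (x : X) (φ : StrongDual 𝕜 X),
      Tendsto (fun t => φ (T.op t x)) u (𝓝 (V x φ)) := by
  obtain ⟨M, hM0, hM⟩ := T.exists_bound
  have hb : ∀ (x : X) (φ : StrongDual 𝕜 X) (t : ℝ≥0), ‖φ (T.op t x)‖ ≤ M * ‖x‖ * ‖φ‖ := by
    intro x φ t
    calc ‖φ (T.op t x)‖ ≤ ‖φ‖ * (M * ‖x‖) :=
          φ.le_of_opNorm_le_of_le le_rfl ((T.op t).le_of_opNorm_le (hM t) x)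
      _ = M * ‖x‖ * ‖φ‖ := by ring
  choose ℓ hℓ using fun (x : X) (φ : StrongDual 𝕜 X) => u.exists_tendsto_of_norm_le (hb x φ)
  have hu {x φ z} (h : Tendsto (fun t => φ (T.op t x)) u (𝓝 z)) : ℓ x φ = z :=
    tendsto_nhds_unique (hℓ x φ) h
  refine ⟨LinearMap.mkContinuous₂ (LinearMap.mk₂ 𝕜 ℓ ?_ ?_ ?_ ?_) M ?_, hℓ⟩
  · exact fun x y φ => hu (by simpa using (hℓ x φ).add (hℓ y φ))
  · exact fun c x φ => hu (by simpa using (hℓ x φ).const_mul c)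
  · exact fun x φ ψ => hu (by simpa using (hℓ x φ).add (hℓ x ψ))
  · exact fun c x φ => hu (by simpa using (hℓ x φ).const_mul c)
  · exact fun x φ => le_of_tendsto (hℓ x φ).norm (Eventually.of_forall (hb x φ))

/-- The adjoint limit preserves `X^⊙`: since the `T(t)` commute, its effect on `φ ∘ T(s) - φ` is
bounded by `M ‖φ ∘ T(s) - φ‖`, which tends to `0` with `s`. -/
theorem exists_isSunLimit (T : BoundedC0Semigroup 𝕜 X) (u : Ultrafilter ℝ≥0) :
    ∃ W, T.IsSunLimit u W := by
  obtain ⟨V, hV⟩ := T.exists_limit_op u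
  obtain ⟨M, hM0, hM⟩ := T.exists_bound
  have hmem : ∀ φ : T.sunDual, eta V φ ∈ T.sunDual := by
    intro φ
    have hφ : Tendsto (fun s : ℝ≥0 => M * ‖(φ : StrongDual 𝕜 X).comp (T.op s) - φ‖) (𝓝 0)
        (𝓝 0) := by
      simpa using (tendsto_iff_norm_sub_tendsto_zero.1 φ.2).const_mul M
    refine tendsto_iff_norm_sub_tendsto_zero.2 (squeeze_zero (fun _ => norm_nonneg _)
      (fun s => ContinuousLinearMap.opNorm_le_bound _ (by positivity) fun x => ?_) hφ)
    refine le_of_tendsto ((hV (T.op s x) φ).sub (hV x φ)).norm (Eventually.of_forall fun t => ?_)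
    calc ‖(φ : StrongDual 𝕜 X) (T.op t (T.op s x)) - (φ : StrongDual 𝕜 X) (T.op t x)‖
        = ‖((φ : StrongDual 𝕜 X).comp (T.op s) - φ) (T.op t x)‖ := by
          rw [T.op_comm_apply]; rfl
      _ ≤ ‖(φ : StrongDual 𝕜 X).comp (T.op s) - φ‖ * (M * ‖x‖) :=
          ContinuousLinearMap.le_of_opNorm_le_of_le _ le_rfl
            ((T.op t).le_of_opNorm_le (hM t) x)
      _ = M * ‖(φ : StrongDual 𝕜 X).comp (T.op s) - φ‖ * ‖x‖ := by ring
  exact ⟨((eta V).comp T.sunDual.subtypeL).codRestrict T.sunDual hmem, fun φ x => hV x φ⟩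

theorem IsSunLimit.mem_sunCompactification {T : BoundedC0Semigroup 𝕜 X} {F : Filter ℝ≥0}
    [F.NeBot] {W : T.sunDual →L[𝕜] T.sunDual} (h : T.IsSunLimit F W) :
    W ∈ T.sunCompactification := by
  -- Refining `F` to an ultrafilter gives a limit on all of `X*`; on `X^⊙` it agrees with `W` by
  -- uniqueness of limits.
  obtain ⟨V, hV⟩ := T.exists_limit_op (Ultrafilter.of F)
  refine ⟨V, ?_, fun φ x => tendsto_nhds_unique ((h φ x).mono_left (Ultrafilter.of_le F))
    (hV x φ)⟩
  let := weakStarOT 𝕜 (StrongDual 𝕜 X) X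
  refine mem_closure_of_tendsto (b := (Ultrafilter.of F : Filter ℝ≥0)) ?_
    (Eventually.of_forall fun t => Set.mem_range_self t)
  rw [nhds_induced, tendsto_comap_iff, tendsto_pi_nhds]
  exact fun p => hV p.2 p.1

theorem exists_isSunLimit_of_mem {T : BoundedC0Semigroup 𝕜 X} {W : T.sunDual →L[𝕜] T.sunDual}
    (hW : W ∈ T.sunCompactification) : ∃ u : Ultrafilter ℝ≥0, T.IsSunLimit u W := by
  obtain ⟨V, hV, h⟩ := hW
  let := weakStarOT 𝕜 (StrongDual 𝕜 X) X
  let F := comap (fun t : ℝ≥0 => eta ((NormedSpace.inclusionInDoubleDual 𝕜 X).comp (T.op t)))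
    (𝓝 (eta V))
  have hne : F.NeBot := comap_nhds_neBot_of_mem_closure_range hV
  refine ⟨Ultrafilter.of F, fun φ x => ?_⟩
  have hu := tendsto_comap.mono_left (Ultrafilter.of_le F)
  rw [nhds_induced, tendsto_comap_iff, tendsto_pi_nhds] at hu
  rw [h]
  exact hu (φ, x)

/-- Here `⟨x, V W φ⟩` is the limit over `t` of `⟨T(t) x, W φ⟩`, itself the limit over `s` of `⟨T(s +
t) x, φ⟩`. -/
theorem IsSunLimit.comp {T : BoundedC0Semigroup 𝕜 X} {F G : Filter ℝ≥0}
    {V W : T.sunDual →L[𝕜] T.sunDual} (hV : T.IsSunLimit F V) (hW : T.IsSunLimit G W) :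
    T.IsSunLimit (F.bind fun t => G.map (· + t)) (V.comp W) := fun φ x =>
  (hV (W φ) x).bind_nhds fun t => tendsto_map'_iff.2 <|
    (hW φ (T.op t x)).congr fun s => by simp [op_add_apply]

theorem comp_mem_sunCompactification {T : BoundedC0Semigroup 𝕜 X}
    {V W : T.sunDual →L[𝕜] T.sunDual} (hV : V ∈ T.sunCompactification)
    (hW : W ∈ T.sunCompactification) : V.comp W ∈ T.sunCompactification := by
  obtain ⟨u, hu⟩ := exists_isSunLimit_of_mem hV
  obtain ⟨v, hv⟩ := exists_isSunLimit_of_mem hW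
  have : ((u : Filter ℝ≥0).bind fun t => (v : Filter ℝ≥0).map (· + t)).NeBot :=
    u.neBot.bind fun t => v.neBot.map _
  exact (hu.comp hv).mem_sunCompactification

/-- The compactification `𝒮₀^⊙` as a semigroup of operators with the weak* operator topology. -/
def SunSemigroup (T : BoundedC0Semigroup 𝕜 X) : Type _ :=
  {W : T.sunDual →L[𝕜] T.sunDual // W ∈ T.sunCompactification}

instance (T : BoundedC0Semigroup 𝕜 X) : Semigroup T.SunSemigroup where
  mul V W := ⟨V.1.comp W.1, comp_mem_sunCompactification V.2 W.2⟩
  mul_assoc _ _ _ := rfl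

instance (T : BoundedC0Semigroup 𝕜 X) : TopologicalSpace T.SunSemigroup :=
  TopologicalSpace.induced
    (fun (V : T.SunSemigroup) (p : T.sunDual × X) => (V.1 p.1 : StrongDual 𝕜 X) p.2)
    Pi.topologicalSpace

/-- The space is a continuous image of the compact space of ultrafilters on `ℝ≥0`. -/
instance (T : BoundedC0Semigroup 𝕜 X) : CompactSpace T.SunSemigroup := by
  choose L hL using T.exists_isSunLimit
  let f : Ultrafilter ℝ≥0 → T.SunSemigroup := fun u => ⟨L u, (hL u).mem_sunCompactification⟩
  have hf : Continuous f := continuous_induced_rng.2 <| continuous_pi fun p =>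
    continuous_of_tendsto_ultrafilter fun u => hL u p.1 p.2
  refine ⟨?_⟩
  convert isCompact_range hf
  refine (Set.range_eq_univ.2 fun W => ?_).symm
  obtain ⟨u, hu⟩ := exists_isSunLimit_of_mem W.2
  exact ⟨u, Subtype.ext <| ContinuousLinearMap.ext fun φ => ext_sunDual fun x =>
    tendsto_nhds_unique (hL u φ x) (hu φ x)⟩

instance (T : BoundedC0Semigroup 𝕜 X) : T2Space T.SunSemigroup := by
  refine T2Space.of_injective_continuous (f := fun (V : T.SunSemigroup) (p : T.sunDual × X) =>
    (V.1 p.1 : StrongDual 𝕜 X) p.2) (fun V W h => ?_) continuous_induced_dom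
  exact Subtype.ext <| ContinuousLinearMap.ext fun φ => ext_sunDual fun x => congr_fun h (φ, x)

instance (T : BoundedC0Semigroup 𝕜 X) : Nonempty T.SunSemigroup := by
  obtain ⟨W, hW⟩ := T.exists_isSunLimit (pure 0)
  exact ⟨⟨W, hW.mem_sunCompactification⟩⟩

/-- Evaluating `V W` at `(φ, x)` is evaluating `V` at `(W φ, x)`. -/
theorem continuous_mul_right_sunSemigroup (T : BoundedC0Semigroup 𝕜 X) (W : T.SunSemigroup) :
    Continuous fun V => V * W := by
  have h : Continuous fun (V : T.SunSemigroup) (p : T.sunDual × X) =>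
    (V.1 p.1 : StrongDual 𝕜 X) p.2 := continuous_induced_dom
  exact continuous_induced_rng.2 <| continuous_pi fun p => continuous_pi_iff.1 h (W.1 p.1, p.2)

theorem exists_isMinimalIdempotent (T : BoundedC0Semigroup 𝕜 X) :
    ∃ P, IsMinimalIdempotent T.sunCompactification P := by
  obtain ⟨P, hP, hmin⟩ :=
    exists_minimal_idempotent_of_compact_t2 T.continuous_mul_right_sunSemigroup
  exact ⟨P.1, P.2, congr_arg Subtype.val hP, fun Q hQ h h' => congr_arg Subtype.val
    (hmin ⟨Q, hQ⟩ (Subtype.ext h) (Subtype.ext h'))⟩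

end BoundedC0Semigroup

/-! ### Consequences of minimality for the splitting of the sun dual. -/

namespace BoundedC0Semigroup

variable {𝕜 X : Type*} [RCLike 𝕜] [NormedAddCommGroup X] [NormedSpace 𝕜 X]

variable {T : BoundedC0Semigroup 𝕜 X} {P : T.sunDual →L[𝕜] T.sunDual}

theorem IsMinimalIdempotent.exists_apply_eq
    (hP : IsMinimalIdempotent T.sunCompactification P) {V : T.sunDual →L[𝕜] T.sunDual}
    (hV : V ∈ T.sunCompactification) :
    ∃ U ∈ T.sunCompactification, ∀ φ, P (U (P (V (P φ)))) = P φ := by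
  obtain ⟨hPS, hPP, hmin⟩ := hP
  let e : T.SunSemigroup := ⟨P, hPS⟩
  let v : T.SunSemigroup := ⟨V, hV⟩
  obtain ⟨U, hU⟩ := exists_mul_mul_eq_of_minimal_idempotent T.continuous_mul_right_sunSemigroup
    (e := e) (Subtype.ext hPP)
    (fun Q h h' => Subtype.ext (hmin Q.1 Q.2 (congr_arg Subtype.val h) (congr_arg Subtype.val h')))
    (e * v)
  refine ⟨U.1, U.2, fun φ => ?_⟩
  have h : U.1 (P (V (P φ))) = P φ := DFunLike.congr_fun (congr_arg Subtype.val hU) φ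
  rw [h]
  exact DFunLike.congr_fun hPP φ

/-- Commutativity of the `T(t)` passes to the limit; this makes range and kernel of `P` invariant.
-/
theorem apply_sunOp {W : T.sunDual →L[𝕜] T.sunDual} (hW : W ∈ T.sunCompactification)
    (s : ℝ≥0) (φ : T.sunDual) : W (T.sunOp s φ) = T.sunOp s (W φ) := by
  obtain ⟨u, hu⟩ := exists_isSunLimit_of_mem hW
  refine ext_sunDual fun x => tendsto_nhds_unique (hu (T.sunOp s φ) x) ?_
  refine (hu φ (T.op s x)).congr fun t => ?_
  rw [sunOp_apply, op_comm_apply]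

theorem IsMinimalIdempotent.apply_apply (hP : IsMinimalIdempotent T.sunCompactification P)
    (φ : T.sunDual) : P (P φ) = P φ :=
  DFunLike.congr_fun hP.2.1 φ

theorem IsMinimalIdempotent.isCompl (hP : IsMinimalIdempotent T.sunCompactification P) :
    IsCompl P.range P.ker :=
  isCompl_of_idempotent (𝕜 := 𝕜) (E := T.sunDual) (P := P) hP.apply_apply

theorem IsMinimalIdempotent.mem_range_iff_forall_exists
    (hP : IsMinimalIdempotent T.sunCompactification P) (φ : T.sunDual) :
    φ ∈ P.range ↔
      ∀ V ∈ T.sunCompactification, ∃ U ∈ T.sunCompactification, P (U (P (V φ))) = φ := by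
  refine ⟨fun hφ V hV => ?_, fun h => ?_⟩
  · obtain ⟨U, hU, h⟩ := hP.exists_apply_eq hV
    have := h φ
    rw [(mem_range_iff_of_idempotent (𝕜 := 𝕜) (E := T.sunDual) (P := P)
      hP.apply_apply).1 hφ] at this
    exact ⟨U, hU, this⟩
  · obtain ⟨U, -, hU⟩ := h P hP.1
    exact ⟨_, hU⟩

theorem tendsto_sunWeakStar_iff {ι : Type*} {F : Filter ι} {f : ι → T.sunDual} {φ : T.sunDual} :
    Tendsto f F (@nhds _ T.sunWeakStar φ) ↔
      ∀ x, Tendsto (fun i => (f i : StrongDual 𝕜 X) x) F (𝓝 ((φ : StrongDual 𝕜 X) x)) := by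
  rw [nhds_induced, tendsto_comap_iff, tendsto_pi_nhds]
  rfl

theorem tendsto_sunWeak_iff {ι : Type*} {F : Filter ι} {f : ι → X} {x : X} :
    Tendsto f F (@nhds _ T.sunWeak x) ↔ ∀ φ : T.sunDual,
      Tendsto (fun i => (φ : StrongDual 𝕜 X) (f i)) F (𝓝 ((φ : StrongDual 𝕜 X) x)) := by
  rw [nhds_induced, tendsto_comap_iff, tendsto_pi_nhds]
  rfl

theorem apply_mem_closure_sunOrbit {W : T.sunDual →L[𝕜] T.sunDual}
    (hW : W ∈ T.sunCompactification) (φ : T.sunDual) :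
    W φ ∈ @closure _ T.sunWeakStar (T.sunOrbit φ) := by
  obtain ⟨u, hu⟩ := exists_isSunLimit_of_mem hW
  let := T.sunWeakStar
  exact mem_closure_of_tendsto (tendsto_sunWeakStar_iff.2 (hu φ))
    (Eventually.of_forall fun t => Set.mem_range_self t)

/-- One net serves all `φ` and `x`, so it can be read both on `X^⊙` and on `X`. -/
theorem exists_net_sunOp {W : T.sunDual →L[𝕜] T.sunDual} (hW : W ∈ T.sunCompactification) :
    ∃ (Γ : Type) (_ : Preorder Γ) (_ : IsDirectedOrder Γ) (_ : Nonempty Γ) (t : Γ → ℝ≥0),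
      ∀ (φ : T.sunDual) (x : X), Tendsto (fun γ => (φ : StrongDual 𝕜 X) (T.op (t γ) x)) atTop
        (𝓝 ((W φ : StrongDual 𝕜 X) x)) := by
  obtain ⟨u, hu⟩ := exists_isSunLimit_of_mem hW
  obtain ⟨Γ, h₁, h₂, h₃, t, ht⟩ := (u : Filter ℝ≥0).exists_net_tendsto
  exact ⟨Γ, h₁, h₂, h₃, t, fun φ x => (hu φ x).comp ht⟩

/-- A limit `W` of the translates kills `P φ`, and `P φ = P U P W P φ` for some `U`. -/
theorem IsMinimalIdempotent.mem_ker_of_tendsto_weak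
    (hP : IsMinimalIdempotent T.sunCompactification P) {φ : T.sunDual} {A : Type*}
    {F : Filter A} [F.NeBot] {t : A → ℝ≥0}
    (h : Tendsto (fun α => toWeakSpace 𝕜 T.sunDual (T.sunOp (t α) φ)) F (𝓝 0)) :
    φ ∈ P.ker := by
  obtain ⟨W, hW⟩ := T.exists_isSunLimit ((Ultrafilter.of F).map t)
  have hWP : W (P φ) = 0 := by
    refine ext_sunDual fun x => ?_
    -- Weak convergence is tested on `ψ ↦ ⟨x, P ψ⟩`, which is norm continuous but need not be weak*
    -- continuous.
    let ev : T.sunDual →L[𝕜] 𝕜 := (ContinuousLinearMap.apply 𝕜 𝕜 x).comp T.sunDual.subtypeL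
    have h₁ := tendsto_apply_of_tendsto_toWeakSpace (𝕜 := 𝕜) (E := T.sunDual)
      (f := fun α => T.sunOp (t α) φ) (h.mono_left (Ultrafilter.of_le F)) (ev.comp P)
    refine tendsto_nhds_unique ((hW (P φ) x).comp tendsto_map) (h₁.congr fun α => ?_)
    change ((P (T.sunOp (t α) φ) : T.sunDual) : StrongDual 𝕜 X) x = _
    rw [apply_sunOp hP.1]
    rfl
  obtain ⟨U, -, hU⟩ := hP.exists_apply_eq hW.mem_sunCompactification
  have := hU φ
  rw [hWP] at this
  simpa using this.symm

theorem norm_sunOp_apply_le {M : ℝ} (hM : ∀ t, ‖T.op t‖ ≤ M) (t : ℝ≥0) (φ : T.sunDual) :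
    ‖T.sunOp t φ‖ ≤ M * ‖φ‖ := by
  rw [mul_comm]
  exact ((φ : StrongDual 𝕜 X).opNorm_comp_le (T.op t)).trans 
    (mul_le_mul_of_nonneg_left (hM t) (norm_nonneg _))

theorem sunOp_add_apply (T : BoundedC0Semigroup 𝕜 X) (s t : ℝ≥0) (φ : T.sunDual) :
    T.sunOp (s + t) φ = T.sunOp s (T.sunOp t φ) :=
  ext_sunDual fun x => by rw [sunOp_apply, add_comm, op_add_apply]; rfl

/-- If a relatively compact orbit has `0` in its weak* closure, it tends to `0` in norm. -/
theorem exists_forall_norm_sunOp_lt {ψ : T.sunDual} {K : Set T.sunDual} (hK : IsCompact K)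
    (hψK : T.sunOrbit ψ ⊆ K) (h0 : 0 ∈ @closure _ T.sunWeakStar (T.sunOrbit ψ)) {ε : ℝ}
    (hε : 0 < ε) : ∃ t₀, ∀ t, t₀ ≤ t → ‖T.sunOp t ψ‖ < ε := by
  have hev : Continuous fun (φ : T.sunDual) (x : X) => (φ : StrongDual 𝕜 X) x :=
    continuous_pi fun x =>
      ((ContinuousLinearMap.apply 𝕜 𝕜 x).comp T.sunDual.subtypeL).continuous
  have h0' : (0 : T.sunDual) ∈ closure (T.sunOrbit ψ) :=
    closure_induced_subset hev (fun φ φ' h => ext_sunDual (congr_fun h)) hK hψK h0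
  obtain ⟨M, hM0, hM⟩ := T.exists_bound
  obtain ⟨_, ⟨t₀, rfl⟩, ht₀⟩ := exists_norm_lt_of_zero_mem_closure (E := T.sunDual) h0'
    (ε := ε / (M + 1)) (by positivity)
  refine ⟨t₀, fun t ht => ?_⟩
  rw [lt_div_iff₀ (by positivity)] at ht₀
  -- Once the orbit is small at `t₀`, the uniform bound `M` keeps it small at all later times.
  obtain ⟨s, rfl⟩ := exists_add_of_le ht
  rw [add_comm, sunOp_add_apply]
  have := norm_sunOp_apply_le hM s (T.sunOp t₀ ψ)
  nlinarith [norm_nonneg (T.sunOp t₀ ψ)]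

theorem IsMinimalIdempotent.mem_range_of_isAlmostPeriodic
    (hP : IsMinimalIdempotent T.sunCompactification P) {φ : T.sunDual} {f : ℝ →ᵇ T.sunDual}
    (hf : IsAlmostPeriodic f) (hfφ : ∀ t : ℝ≥0, f (t : ℝ) = T.sunOp t φ) : φ ∈ P.range := by
  have hf0 : f 0 = φ := by
    rw [← NNReal.coe_zero, hfφ]
    exact ext_sunDual fun x => by rw [sunOp_apply, T.op_zero]; rfl
  refine ⟨φ, apply_eq_of_isAlmostPeriodic (𝕜 := 𝕜) (E := T.sunDual) (P := P) (φ := φ) hf hf0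
    fun K hK hKf ε hε => ?_⟩
  have hsub : ∀ t, T.sunOp t (φ - P φ) = f t - P (f t) := fun t => by
    rw [hfφ, apply_sunOp hP.1]
    rfl
  have h0 : P (φ - P φ) = 0 := sub_mem_ker_of_idempotent (𝕜 := 𝕜) (E := T.sunDual) (P := P)
    hP.apply_apply φ
  -- `P` kills `φ - P φ`, so `0` lies in the weak* closure of its orbit.
  obtain ⟨t₀, ht₀⟩ := exists_forall_norm_sunOp_lt (ψ := φ - P φ) hK
    (Set.range_subset_iff.2 fun t => (hsub t).symm ▸ hKf t)
    (h0 ▸ apply_mem_closure_sunOrbit hP.1 (φ - P φ)) hε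
  refine ⟨t₀, fun t ht => ?_⟩
  lift t to ℝ≥0 using t₀.2.trans ht
  exact hsub t ▸ ht₀ t (by exact_mod_cast ht)

end BoundedC0Semigroup

/-! ### The splitting theorem. -/

theorem theorem5p9 {𝕜 X : Type*} [RCLike 𝕜] [NormedAddCommGroup X]
    [NormedSpace 𝕜 X] [CompleteSpace X] (T : BoundedC0Semigroup 𝕜 X) :
    (∃ P, BoundedC0Semigroup.IsMinimalIdempotent T.sunCompactification P) ∧
    ∀ P : T.sunDual →L[𝕜] T.sunDual,
      BoundedC0Semigroup.IsMinimalIdempotent T.sunCompactification P →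
      -- the decomposition into closed, translation-invariant subspaces
      (IsCompl P.range P.ker ∧
        IsClosed (P.range : Set T.sunDual) ∧ IsClosed (P.ker : Set T.sunDual) ∧
        (∀ t : ℝ≥0, ∀ φ ∈ P.range, T.sunOp t φ ∈ P.range) ∧
        (∀ t : ℝ≥0, ∀ φ ∈ P.ker, T.sunOp t φ ∈ P.ker)) ∧
      -- `P S₀` is a group on the range of `P`
      BoundedC0Semigroup.IsGroupOnRange T.sunCompactification P ∧
      -- reversibility characterizes the range of `P`
      (∀ φ : T.sunDual, φ ∈ P.range ↔
        ∀ V ∈ T.sunCompactification, ∃ U ∈ T.sunCompactification, P (U (P (V φ))) = φ) ∧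
      -- weak* null nets of translates for vectors of the kernel
      (∀ φ ∈ P.ker, ∃ (Γ : Type) (_ : Preorder Γ) (_ : IsDirectedOrder Γ) (_ : Nonempty Γ)
        (t : Γ → ℝ≥0),
        Tendsto (fun γ => T.sunOp (t γ) φ) atTop (@nhds _ T.sunWeakStar 0)) ∧
      -- almost periodic vectors lie in the range
      (∀ φ : T.sunDual,
        (∃ f : ℝ →ᵇ T.sunDual, BoundedC0Semigroup.IsAlmostPeriodic f ∧
          ∀ t : ℝ≥0, f (t : ℝ) = T.sunOp t φ) → φ ∈ P.range) ∧
      -- vectors with a weakly null net of translates lie in the kernel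
      (∀ φ : T.sunDual, ∀ (A : Type*) [Preorder A] [IsDirectedOrder A] [Nonempty A]
        (t : A → ℝ≥0),
        Tendsto (fun α => toWeakSpace 𝕜 T.sunDual (T.sunOp (t α) φ)) atTop (𝓝 0) →
          φ ∈ P.ker) ∧
      -- vectors of `X` annihilated by the range
      (∀ x : X, (∀ φ ∈ P.range, (φ : StrongDual 𝕜 X) x = 0) →
        ∃ (A : Type) (_ : Preorder A) (_ : IsDirectedOrder A) (_ : Nonempty A) (t : A → ℝ≥0),
          Tendsto (fun α => T.op (t α) x) atTop (@nhds _ T.sunWeak 0)) ∧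
      -- vectors of `X` annihilated by the kernel
      (∀ x : X, (∀ φ ∈ P.ker, (φ : StrongDual 𝕜 X) x = 0) →
        ∃ (A : Type) (_ : Preorder A) (_ : IsDirectedOrder A) (_ : Nonempty A) (t : A → ℝ≥0),
          Tendsto (fun α => T.op (t α) x) atTop (@nhds _ T.sunWeak x)) ∧
      -- splitting of closed subspaces that contain weak* orbit closures
      (∀ Y : Submodule 𝕜 T.sunDual, IsClosed (Y : Set T.sunDual) →
        (∀ φ ∈ Y, @closure _ T.sunWeakStar (T.sunOrbit φ) ⊆ (Y : Set T.sunDual) →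
          ∀ φa ∈ P.range, ∀ φ0 ∈ P.ker, φ = φa + φ0 → φa ∈ Y ∧ φ0 ∈ Y) ∧
        ((∀ φ ∈ Y, @closure _ T.sunWeakStar (T.sunOrbit φ) ⊆ (Y : Set T.sunDual)) →
          Disjoint (Y ⊓ P.range) (Y ⊓ P.ker) ∧ (Y ⊓ P.range) ⊔ (Y ⊓ P.ker) = Y)) := by
  refine ⟨T.exists_isMinimalIdempotent, fun P hP => ⟨⟨hP.isCompl,
    isClosed_range_of_idempotent (𝕜 := 𝕜) (E := T.sunDual) (P := P) hP.apply_apply, P.isClosed_ker, ?_, ?_⟩,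
    BoundedC0Semigroup.isGroupOnRange_of_idempotent (𝕜 := 𝕜) (E := T.sunDual) (P := P)
      (fun _ hV _ hW => BoundedC0Semigroup.comp_mem_sunCompactification hV hW) hP.1
      hP.apply_apply fun _ hV => hP.exists_apply_eq hV,
    hP.mem_range_iff_forall_exists, ?_,
    fun φ ⟨f, hf, hfφ⟩ => hP.mem_range_of_isAlmostPeriodic hf hfφ,
    fun φ A _ _ _ t h => hP.mem_ker_of_tendsto_weak h, ?_, ?_, ?_⟩⟩
  · rintro t _ ⟨ψ, rfl⟩
    exact ⟨T.sunOp t ψ, BoundedC0Semigroup.apply_sunOp hP.1 t ψ⟩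
  · intro t φ hφ
    have hφ' : P φ = 0 := hφ
    rw [LinearMap.mem_ker]
    exact (BoundedC0Semigroup.apply_sunOp hP.1 t φ).trans (by rw [hφ', map_zero])
  · intro φ hφ
    have hφ' : P φ = 0 := hφ
    obtain ⟨Γ, h₁, h₂, h₃, t, ht⟩ := BoundedC0Semigroup.exists_net_sunOp hP.1
    exact ⟨Γ, h₁, h₂, h₃, t, BoundedC0Semigroup.tendsto_sunWeakStar_iff.2 fun x =>
      hφ' ▸ ht φ x⟩
  · intro x hx
    obtain ⟨A, h₁, h₂, h₃, t, ht⟩ := BoundedC0Semigroup.exists_net_sunOp hP.1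
    refine ⟨A, h₁, h₂, h₃, t, BoundedC0Semigroup.tendsto_sunWeak_iff.2 fun φ => ?_⟩
    -- The net limit `⟨x, P φ⟩` vanishes because `P φ` is in the range.
    rw [map_zero, ← hx (P φ) ⟨φ, rfl⟩]
    exact ht φ x
  · intro x hx
    obtain ⟨A, h₁, h₂, h₃, t, ht⟩ := BoundedC0Semigroup.exists_net_sunOp hP.1
    refine ⟨A, h₁, h₂, h₃, t, BoundedC0Semigroup.tendsto_sunWeak_iff.2 fun φ => ?_⟩
    have h := hx (φ - P φ) (sub_mem_ker_of_idempotent (𝕜 := 𝕜) (E := T.sunDual) (P := P) hP.apply_apply φ)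
    have h' : (φ : StrongDual 𝕜 X) x = (P φ : StrongDual 𝕜 X) x := by
      simpa [sub_eq_zero] using h
    rw [h']
    exact ht φ x
  · intro Y _
    -- `P φ` is a weak* limit of the orbit, so it lies in `Y`, and then so does `φ - P φ`.
    have key : ∀ φ ∈ Y, @closure _ T.sunWeakStar (T.sunOrbit φ) ⊆ (Y : Set T.sunDual) →
        P φ ∈ Y := fun φ _ h => h (BoundedC0Semigroup.apply_mem_closure_sunOrbit hP.1 φ)
    refine ⟨fun φ hφ h φa ha φ0 h0 hsum => ?_, fun h =>
      ⟨Disjoint.mono inf_le_right inf_le_right hP.isCompl.disjoint, ?_⟩⟩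
    · exact components_mem_of_idempotent (𝕜 := 𝕜) (E := T.sunDual) (P := P) (Y := Y)
        hP.apply_apply hφ (key φ hφ h) ha h0 hsum
    · refine Submodule.inf_sup_inf_eq_left fun φ hφ => ?_
      obtain ⟨ψ, hψ, hsum⟩ := exists_mem_ker_add_eq_of_idempotent (𝕜 := 𝕜) (E := T.sunDual)
        (P := P) hP.apply_apply φ
      have hY := components_mem_of_idempotent (𝕜 := 𝕜) (E := T.sunDual) (P := P) (Y := Y)
        hP.apply_apply hφ (key φ hφ (h φ hφ)) ⟨φ, rfl⟩ hψ hsum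
      exact ⟨P φ, ⟨hY.1, φ, rfl⟩, ψ, ⟨hY.2, hψ⟩, hsum.symm⟩
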